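/- Fix $d\ge 0$ and let $g$ be a standard Gaussian vector in the Euclidean space $\mathbb R^d$. For a closed convex cone $C\subseteq\mathbb R^d$ let $\Pi_C(x)$ be the point of $C$ nearest to $x$ and let $C^\circ=\{u:\langle u,x\rangle\le 0\ \text{for all }x\in C\}$ be the polar cone. For a Borel function $f:\mathbb R_+^2\to\mathbb R$ put $$\varphi_f(C)=\mathbb E\, f\big(\|\Pi_C(g)\|^2,\|\Pi_{C^\circ}(g)\|^2\big).$$ *Intrinsic volumes.* A cone is polyhedral if it is a finite intersection of halfspaces $\{x:\langle u,x\rangle\ge 0\}$; its faces are the nonempty sets of points at which some linear functional $\langle u,\cdot\rangle$ attains its maximum over the cone, and the dimension of a face is the dimension of its linear hull. For polyhedral $C$ and $0\le k\le d$, $v_k(C)$ is the probability that $\Pi_C(g)$ lies in the relative interior of a $k$-dimensional face of $C$. For a general closed convex cone, $v_k(C)=\lim_i v_k(C_i)$ for any sequence of polyhedral cones $C_i\to C$ in the conic Hausdorff metric, that is, the infimum of the $\alpha\ge 0$ such that every vector of each of the two cones is within angular distance $\alpha$ of some vector of the other one (the angular distance of nonzero vectors is the angle between them; it is $\pi/2$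 if exactly one of the vectors is $0$, and $0$ if both are). **Theorem (Master Steiner formula for cones).** Let $C\subseteq\mathbb R^d$ be a closed convex cone. 1. The numbers $v_k(C)$, $0\le k\le d$, are well defined: there is a sequence of polyhedral cones converging to $C$, and for every such sequence $(C_i)$ the limit $\lim_i v_k(C_i)$ exists and has the same value $v_k(C)$. 2. Let $f:\mathbb R_+^2\to\mathbb R$ be Borel, and for each $0\le k\le d$ let $L_k$ be a $k$-dimensional linear subspace of $\mathbb R^d$. If the expectations defining $\varphi_f(C)$ and $\varphi_f(L_0),\dots,\varphi_f(L_d)$ are finite (as Lebesgue integrals), then $$\varphi_f(C)=\sum_{k=0}^d\varphi_f(L_k)\,v_k(C).$$ 3. Let $X_0,\dots,X_d,X'_0,\dots,X'_d$ be independent random variables such that $X_k$ and $X'_k$ have the chi-square distribution with $k$ degrees of freedom (a chi-square variable with $0$ degrees of freedom is identically $0$). Let $f:\mathbb R_+^2\to\mathbb R$ be Borel. If the expectations defining $\varphi_f(C)$ and $\mathbb E f(X_k,X'_{d-k})$, $0\le k\le d$, are finite, then $$\varphi_f(C)=\sum_{k=0}^d\mathbb E\big[f(X_k,X'_{d-k})\big]\,v_k(C).$$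 4. Consequently $\|\Pi_C(g)\|^2$ is a mixture of chi-square variables with weights $v_k(C)$: we have $v_k(C)\ge 0$, $\sum_{k=0}^d v_k(C)=1$, and the law of $\|\Pi_C(g)\|^2$ is $\sum_{k=0}^d v_k(C)\,\mathcal L(X_k)$. -/

import Mathlib

open MeasureTheory ProbabilityTheory Filter Topology
open scoped NNReal ENNReal

namespace ConicSteiner

/-- The Euclidean space of dimension `d`. -/
abbrev E (d : ℕ) : Type := EuclideanSpace ℝ (Fin d)

/-- Closed convex cones of the Euclidean space. A nonempty closed set that is stable under
addition and positive scaling contains the origin, so these are exactly the proper cones. -/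
abbrev Cone (d : ℕ) : Type := ProperCone ℝ (E d)

variable {d : ℕ}

/-- A cone is polyhedral if it is a finite intersection of halfspaces `⟪u, x⟫ ≥ 0`. -/
def IsPolyhedral (C : Cone d) : Prop :=
  ∃ s : Finset (E d), (C : Set (E d)) = {x | ∀ u ∈ s, 0 ≤ inner ℝ u x}

/-- The polar cone `{u | ⟪u, x⟫ ≤ 0 for all x ∈ C}`, see `mem_polar`. -/
noncomputable def polar (C : Cone d) : Cone d :=
  ProperCone.innerDual {y : E d | -y ∈ C}

theorem mem_polar {C : Cone d} {u : E d} :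
    u ∈ polar C ↔ ∀ x ∈ C, inner ℝ u x ≤ 0 := by
  simp only [polar, ProperCone.mem_innerDual, Set.mem_ofPred_eq]
  constructor
  · intro h x hx
    have := h (x := -x) (by simpa using hx)
    rw [inner_neg_left, real_inner_comm] at this
    linarith
  · intro h x hx
    have := h (-x) hx
    rw [inner_neg_right, real_inner_comm] at this
    linarith

/-- A linear subspace, viewed as a closed convex cone. -/
def subspaceCone (L : Submodule ℝ (E d)) : Cone d where
  toSubmodule := PointedCone.ofSubmodule L
  isClosed' := L.closed_of_finiteDimensional

theorem mem_subspaceCone {L : Submodule ℝ (E d)} {x : E d} : x ∈ subspaceCone L ↔ x ∈ L :=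
  Iff.rfl

theorem exists_nearest (C : Cone d) (x : E d) : ∃ y ∈ C, ∀ z ∈ C, ‖x - y‖ ≤ ‖x - z‖ := by
  obtain ⟨y, hy, h⟩ := C.isClosed.exists_infDist_eq_dist ⟨0, C.zero_mem⟩ x
  refine ⟨y, hy, fun z hz => ?_⟩
  rw [← dist_eq_norm, ← dist_eq_norm, ← h]
  exact Metric.infDist_le_dist_of_mem hz

/-- The metric projector onto a closed convex cone: the point of `C` nearest to `x`. -/
noncomputable def proj (C : Cone d) (x : E d) : E d :=
  (exists_nearest C x).choose

theorem proj_mem (C : Cone d) (x : E d) : proj C x ∈ C :=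
  (exists_nearest C x).choose_spec.1

theorem norm_sub_proj_le (C : Cone d) (x : E d) {z : E d} (hz : z ∈ C) :
    ‖x - proj C x‖ ≤ ‖x - z‖ :=
  (exists_nearest C x).choose_spec.2 z hz

/-- The exposed face `F(u)` of `C` with outward normal `u`: the points of `C` at which the linear
functional `⟪u, ·⟫` attains its maximum over `C`. It is empty unless `u` is in the polar cone. -/
def face (C : Cone d) (u : E d) : Set (E d) :=
  {x | x ∈ C ∧ ∀ y ∈ C, inner ℝ u y ≤ inner ℝ u x}

/-- The dimension of a convex set containing the origin: the dimension of its linear hull. -/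
noncomputable def dimHull (F : Set (E d)) : ℕ :=
  Module.finrank ℝ (Submodule.span ℝ F)

/-- The `k`th conic intrinsic volume of a polyhedral cone: the probability that the projection of
a standard Gaussian vector lies in the relative interior of a `k`-dimensional face. (A nonempty
face contains the origin, so that its affine and linear hulls agree.) -/
noncomputable def polyhedralVolume (C : Cone d) (k : ℕ) : ℝ :=
  (stdGaussian (E d)).real
    {g | ∃ u : E d, dimHull (face C u) = k ∧ proj C g ∈ intrinsicInterior ℝ (face C u)}

open Classical in
/-- The angular distance of two vectors. Mathlib's angle is `arccos (⟪x, y⟫ / (‖x‖ * ‖y‖))`, which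
is `π / 2` as soon as one of the vectors vanishes. -/
noncomputable def angDist (x y : E d) : ℝ :=
  if x = 0 ∧ y = 0 then 0 else InnerProductGeometry.angle x y

/-- The angular expansion of a cone by the angle `α`. -/
def angExpansion (C : Cone d) (α : ℝ) : Set (E d) :=
  {x | ∃ y ∈ C, angDist x y ≤ α}

/-- The conic Hausdorff metric. -/
noncomputable def hausDist (C₁ C₂ : Cone d) : ℝ :=
  sInf {α : ℝ | 0 ≤ α ∧ (C₂ : Set (E d)) ⊆ angExpansion C₁ α ∧
    (C₁ : Set (E d)) ⊆ angExpansion C₂ α}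

/-- The sequence `K` consists of polyhedral cones and converges to `C` in the conic Hausdorff
metric. -/
def PolyhedralApprox (K : ℕ → Cone d) (C : Cone d) : Prop :=
  (∀ i, IsPolyhedral (K i)) ∧ Tendsto (fun i => hausDist (K i) C) atTop (𝓝 0)

/-- The `k`th conic intrinsic volume of a closed convex cone: the number that is the limit of the
`k`th intrinsic volumes of every sequence of polyhedral cones converging to `C`. -/
noncomputable def intrinsicVolume (C : Cone d) (k : ℕ) : ℝ :=
  Classical.epsilon fun v : ℝ => ∀ K : ℕ → Cone d, PolyhedralApprox K C →
    Tendsto (fun i => polyhedralVolume (K i) k) atTop (𝓝 v)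

/-- The pair `(‖Π_C(x)‖², ‖Π_{C°}(x)‖²)`. -/
noncomputable def sqNorms (C : Cone d) (x : E d) : ℝ≥0 × ℝ≥0 :=
  (‖proj C x‖₊ ^ 2, ‖proj (polar C) x‖₊ ^ 2)

/-- The expectation defining `φ_f(C)` is finite, as a Lebesgue integral. -/
def FinitePhi (f : ℝ≥0 × ℝ≥0 → ℝ) (C : Cone d) : Prop :=
  Integrable (fun g => f (sqNorms C g)) (stdGaussian (E d))

/-- `φ_f(C) = 𝔼 f(‖Π_C(g)‖², ‖Π_{C°}(g)‖²)` for a standard Gaussian vector `g`. -/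
noncomputable def phi (f : ℝ≥0 × ℝ≥0 → ℝ) (C : Cone d) : ℝ :=
  ∫ g, f (sqNorms C g) ∂(stdGaussian (E d))

/-- The chi-square distribution with `k` degrees of freedom: the law of the sum of the squares of
`k` independent standard normal variables (the point mass at `0` when `k = 0`). -/
noncomputable def chiSquare (k : ℕ) : Measure ℝ≥0 :=
  (Measure.pi fun _ : Fin k => gaussianReal 0 1).map fun z => ∑ i, ‖z i‖₊ ^ 2

end ConicSteiner

/-! ### Metric projections onto closed convex cones. -/

namespace ConicSteiner

variable {d : ℕ}

/-! Everything is read off the Laplace transform of the pair `sqNorms C g`. Let `C` be cut out by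
finitely many inequalities, and split the space according to the set `A` of inequalities that are
active at the projection. On such a piece the projection is the orthogonal projection onto a
subspace `V`, and the piece is stable under independent positive scalings of `V` and its complement.
Weighting the Gaussian by `exp (-(s‖x_V‖² + t‖x_V'‖²))` is, up to a constant, the same as such a
scaling (`stdGaussian_withDensity_exp`). Hence the transform over the piece is its Gaussian mass
times `λ(s)^k λ(t)^(d-k)`, where `k = dim V` and `λ(s) = (1 + 2s)^(-1/2)`
(`setIntegral_expNeg_sqNorms`). Summing over `A` gives `∑ v_k λ(s)^k λ(t)^(d-k)`.

For `t = 0` and `s = 0, ..., d` this is an invertible Vandermonde system, so the `v_k` are fixed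
linear combinations of Gaussian integrals (`polyhedralVolume_eq_mulVec`). These integrals are
continuous in the cone because the projection is (`tendsto_proj`), and polyhedral cones are dense.
So the limits `v_k` exist, and the transform identity passes to every closed convex cone.

The transform determines the law, so the law of `sqNorms C g` is the `v_k`-mixture of products of
chi-square laws (`map_sqNorms_stdGaussian`). Both Steiner formulas are integrals of `f` against this
identity, and the mixture statement is its first marginal. -/

theorem inner_sub_proj_sub_le (C : Cone d) (x : E d) {w : E d} (hw : w ∈ C) :
    inner ℝ (x - proj C x) (w - proj C x) ≤ 0 := by
  have hconv : Convex ℝ (C : Set (E d)) := C.toPointedCone.convex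
  have : Nonempty (C : Set (E d)) := ⟨⟨0, C.zero_mem⟩⟩
  refine (norm_eq_iInf_iff_real_inner_le_zero hconv (proj_mem C x)).1 (le_antisymm ?_ ?_) w hw
  · exact le_ciInf fun z => norm_sub_proj_le C x z.2
  · exact ciInf_le ⟨0, by rintro _ ⟨z, rfl⟩; positivity⟩
      (⟨proj C x, proj_mem C x⟩ : (C : Set (E d)))

theorem inner_sub_proj_le (C : Cone d) (x : E d) {z : E d} (hz : z ∈ C) :
    inner ℝ (x - proj C x) z ≤ 0 := by
  simpa using inner_sub_proj_sub_le C x (C.add_mem hz (proj_mem C x))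

theorem inner_sub_proj_proj (C : Cone d) (x : E d) :
    inner ℝ (x - proj C x) (proj C x) = 0 := by
  refine le_antisymm (inner_sub_proj_le C x (proj_mem C x)) ?_
  have := inner_sub_proj_sub_le C x C.zero_mem
  rw [zero_sub, inner_neg_right] at this
  linarith

theorem sub_proj_mem_polar (C : Cone d) (x : E d) : x - proj C x ∈ polar C :=
  mem_polar.2 fun _ hz => inner_sub_proj_le C x hz

/-- Uniqueness: adding the conditions for `y` to those for `proj C x` gives `‖proj C x - y‖² ≤ 0`.
-/
theorem proj_eq_of_inner {C : Cone d} {x y : E d} (hy : y ∈ C)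
    (hle : ∀ z ∈ C, inner ℝ (x - y) z ≤ 0) (h0 : inner ℝ (x - y) y = 0) : proj C x = y := by
  have h1 := hle _ (proj_mem C x)
  have h2 := inner_sub_proj_le C x hy
  have h3 := inner_sub_proj_proj C x
  rw [← sub_eq_zero, ← real_inner_self_nonpos]
  have : inner ℝ (proj C x - y) (proj C x - y) =
      inner ℝ ((x - y) - (x - proj C x)) (proj C x - y) := by congr 1; abel
  rw [this, inner_sub_left, inner_sub_right, inner_sub_right]
  linarith

/-- Moreau's decomposition. The residual of `x - proj C x` is `proj C x`, so the criterion for the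
polar cone is the one for `C` with the two roles exchanged. -/
theorem proj_polar (C : Cone d) (x : E d) : proj (polar C) x = x - proj C x := by
  refine proj_eq_of_inner (sub_proj_mem_polar C x) (fun z hz => ?_) ?_
  · rw [sub_sub_cancel, real_inner_comm]
    exact mem_polar.1 hz _ (proj_mem C x)
  · rw [sub_sub_cancel, real_inner_comm]
    exact inner_sub_proj_proj C x

theorem norm_proj_sub_proj_le (C : Cone d) (x y : E d) : ‖proj C x - proj C y‖ ≤ ‖x - y‖ := by
  have h1 := inner_sub_proj_sub_le C x (proj_mem C y)
  have h2 := inner_sub_proj_sub_le C y (proj_mem C x)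
  have h3 : ‖proj C x - proj C y‖ * ‖proj C x - proj C y‖ ≤ ‖x - y‖ * ‖proj C x - proj C y‖ := by
    refine le_trans ?_ (real_inner_le_norm (x - y) (proj C x - proj C y))
    rw [← real_inner_self_eq_norm_mul_norm]
    have e1 : inner ℝ (x - proj C x) (proj C y - proj C x) =
        - inner ℝ (x - proj C x) (proj C x - proj C y) := by
      rw [← inner_neg_right, neg_sub]
    have e2 : inner ℝ (proj C x - proj C y) (proj C x - proj C y) =
        inner ℝ (x - y) (proj C x - proj C y) - inner ℝ (x - proj C x) (proj C x - proj C y)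
          + inner ℝ (y - proj C y) (proj C x - proj C y) := by
      rw [← inner_sub_left, ← inner_add_left]; congr 1; abel
    linarith
  rcases (norm_nonneg (proj C x - proj C y)).eq_or_lt with h | h
  · rw [← h]; positivity
  · exact le_of_mul_le_mul_right h3 h

theorem continuous_proj (C : Cone d) : Continuous (proj C) :=
  (LipschitzWith.of_dist_le_mul (K := 1) fun x y => by
    simpa [dist_eq_norm] using norm_proj_sub_proj_le C x y).continuous

theorem norm_proj_le (C : Cone d) (x : E d) : ‖proj C x‖ ≤ ‖x‖ := by
  have h0 : proj C 0 = 0 := proj_eq_of_inner C.zero_mem (by simp) (by simp)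
  simpa [h0] using norm_proj_sub_proj_le C x 0

theorem continuous_sqNorms (C : Cone d) : Continuous (sqNorms C) :=
  ((continuous_proj C).nnnorm.pow 2).prodMk ((continuous_proj _).nnnorm.pow 2)

theorem measurable_sqNorms (C : Cone d) : Measurable (sqNorms C) :=
  (continuous_sqNorms C).measurable

end ConicSteiner
-- Exponentially weighted Gaussian measures.
namespace ConicSteiner

/-- On a box the integrand is a product of functions of independent coordinates. -/
theorem withDensity_pi_prod {ι : Type*} [Fintype ι] {X : ι → Type*} [∀ i, MeasurableSpace (X i)]
    (μ : ∀ i, Measure (X i)) [∀ i, IsProbabilityMeasure (μ i)] {ρ : ∀ i, X i → ℝ≥0∞}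
    (hρ : ∀ i, Measurable (ρ i)) [∀ i, SigmaFinite ((μ i).withDensity (ρ i))] :
    (Measure.pi μ).withDensity (fun z => ∏ i, ρ i (z i)) =
      Measure.pi fun i => (μ i).withDensity (ρ i) := by
  refine (Measure.pi_eq fun S hS => ?_).symm
  rw [withDensity_apply _ (MeasurableSet.univ_pi hS),
    ← lintegral_indicator (MeasurableSet.univ_pi hS)]
  have hm : ∀ i, Measurable ((S i).indicator (ρ i)) := fun i => (hρ i).indicator (hS i)
  have h1 : ∀ z : ∀ i, X i, (Set.univ.pi S).indicator (fun z => ∏ i, ρ i (z i)) z =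
      ∏ i, (S i).indicator (ρ i) (z i) := by
    intro z
    by_cases hz : z ∈ Set.univ.pi S
    · rw [Set.indicator_of_mem hz]
      exact Finset.prod_congr rfl fun i _ => (Set.indicator_of_mem (hz i trivial) _).symm
    · rw [Set.indicator_of_notMem hz]
      simp only [Set.mem_pi, Set.mem_univ, true_imp_iff, not_forall] at hz
      obtain ⟨i, hi⟩ := hz
      exact (Finset.prod_eq_zero (Finset.mem_univ i) (Set.indicator_of_notMem hi _)).symm
  simp_rw [h1]
  have hind : iIndepFun (fun i (z : ∀ i, X i) => (S i).indicator (ρ i) (z i)) (Measure.pi μ) :=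
    iIndepFun_pi (X := fun i => (S i).indicator (ρ i)) fun i => (hm i).aemeasurable
  rw [lintegral_prod_eq_prod_lintegral_of_indepFun _ _ hind
    fun i => (hm i).comp (measurable_pi_apply i)]
  refine Finset.prod_congr rfl fun i _ => ?_
  rw [withDensity_apply _ (hS i), ← lintegral_indicator (hS i)]
  exact (measurePreserving_eval μ i).lintegral_comp (hm i)

/-- The Laplace transform at `s` of the chi-square distribution with one degree of freedom. -/
noncomputable def laplaceFactor (s : ℝ) : ℝ := (√(1 + 2 * s))⁻¹

theorem laplaceFactor_pos {s : ℝ} (hs : 0 ≤ s) : 0 < laplaceFactor s := by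
  unfold laplaceFactor; positivity

theorem laplaceFactor_zero : laplaceFactor 0 = 1 := by simp [laplaceFactor]

/-- The exponents add up to `-(1 + 2s)x²/2`, a centred Gaussian of variance `laplaceFactor s ^ 2`;
the mismatch of the normalising constants is the total mass. -/
theorem gaussianReal_withDensity_exp {s : ℝ} (hs : 0 ≤ s) :
    (gaussianReal 0 1).withDensity (fun x => ENNReal.ofReal (Real.exp (-(s * x ^ 2)))) =
      ENNReal.ofReal (laplaceFactor s) •
        (gaussianReal 0 1).map (fun x => laplaceFactor s * x) := by
  have ha := laplaceFactor_pos hs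
  have hq : 0 < 1 + 2 * s := by positivity
  have hsq : laplaceFactor s ^ 2 = (1 + 2 * s)⁻¹ := by
    rw [laplaceFactor, inv_pow, Real.sq_sqrt hq.le]
  have hv : NNReal.mk (laplaceFactor s ^ 2) (sq_nonneg _) * 1 ≠ 0 := by
    rw [mul_one, Ne, ← NNReal.coe_inj]
    exact (pow_pos ha 2).ne'
  rw [gaussianReal_map_const_mul, mul_zero, gaussianReal_of_var_ne_zero _ one_ne_zero,
    gaussianReal_of_var_ne_zero _ hv, ← withDensity_mul _ (measurable_gaussianPDF _ _) (by fun_prop),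
    ← withDensity_smul _ (measurable_gaussianPDF _ _)]
  congr 1
  ext x
  simp only [Pi.mul_apply, Pi.smul_apply, smul_eq_mul, gaussianPDF]
  rw [← ENNReal.ofReal_mul (gaussianPDFReal_nonneg _ _ _), ← ENNReal.ofReal_mul ha.le]
  congr 1
  simp only [gaussianPDFReal, NNReal.coe_one, mul_one, sub_zero, NNReal.coe_mk]
  rw [Real.sqrt_mul (by positivity) (laplaceFactor s ^ 2), Real.sqrt_sq ha.le, mul_inv, hsq]
  rw [mul_assoc, ← Real.exp_add, mul_comm (√_)⁻¹ (laplaceFactor s)⁻¹, mul_assoc, ← mul_assoc,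
    mul_inv_cancel₀ ha.ne', one_mul]
  congr 2
  field_simp
  ring

theorem pi_gaussianReal_withDensity_exp {ι : Type*} [Fintype ι] {σ : ι → ℝ} (hσ : ∀ i, 0 ≤ σ i) :
    (Measure.pi fun _ : ι => gaussianReal 0 1).withDensity
        (fun z => ENNReal.ofReal (Real.exp (-∑ i, σ i * z i ^ 2))) =
      ENNReal.ofReal (∏ i, laplaceFactor (σ i)) •
        (Measure.pi fun _ : ι => gaussianReal 0 1).map
          (fun z i => laplaceFactor (σ i) * z i) := by
  have h1 : (fun z : ι → ℝ => ENNReal.ofReal (Real.exp (-∑ i, σ i * z i ^ 2))) =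
      fun z => ∏ i, ENNReal.ofReal (Real.exp (-(σ i * z i ^ 2))) := by
    ext z
    rw [← ENNReal.ofReal_prod_of_nonneg fun _ _ => (Real.exp_pos _).le, ← Real.exp_sum,
      Finset.sum_neg_distrib]
  have hprob : ∀ i, IsProbabilityMeasure
      ((gaussianReal 0 1).map (fun x => laplaceFactor (σ i) * x)) := fun i =>
    Measure.isProbabilityMeasure_map (by fun_prop)
  have h2 : ∀ i, (gaussianReal 0 1).withDensity
      (fun x => ENNReal.ofReal (Real.exp (-(σ i * x ^ 2)))) =
      ENNReal.ofReal (laplaceFactor (σ i)) •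
        (gaussianReal 0 1).map (fun x => laplaceFactor (σ i) * x) := fun i =>
    gaussianReal_withDensity_exp (hσ i)
  have hfin : ∀ i, IsFiniteMeasure ((gaussianReal 0 1).withDensity
      (fun x => ENNReal.ofReal (Real.exp (-(σ i * x ^ 2))))) := fun i => by
    rw [h2]; exact Measure.smul_finite _ ENNReal.ofReal_ne_top
  rw [h1, withDensity_pi_prod (fun _ => gaussianReal 0 1)
    (ρ := fun i x => ENNReal.ofReal (Real.exp (-(σ i * x ^ 2)))) (fun i => by fun_prop),
    Measure.pi_map_pi (fun i => by fun_prop)]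
  refine Measure.pi_eq fun S hS => ?_
  simp_rw [h2]
  rw [Measure.smul_apply, Measure.pi_pi,
    ENNReal.ofReal_prod_of_nonneg fun i _ => (laplaceFactor_pos (hσ i)).le, smul_eq_mul,
    ← Finset.prod_mul_distrib]
  simp

theorem norm_sq_sum_smul {ι F : Type*} [Fintype ι] [NormedAddCommGroup F] [InnerProductSpace ℝ F]
    (v : OrthonormalBasis ι ℝ F) (z : ι → ℝ) : ‖∑ i, z i • v i‖ ^ 2 = ∑ i, z i ^ 2 := by
  rw [← v.sum_sq_inner_right]
  simp_rw [v.orthonormal.inner_right_fintype]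

variable {d : ℕ}

/-- The linear map that scales `V` by `a` and the orthogonal complement of `V` by `b`. -/
noncomputable def biscale (V : Submodule ℝ (E d)) (a b : ℝ) (x : E d) : E d :=
  a • V.starProjection x + b • Vᗮ.starProjection x

theorem continuous_biscale (V : Submodule ℝ (E d)) (a b : ℝ) : Continuous (biscale V a b) := by
  unfold biscale; fun_prop

/-- Weighting the standard Gaussian by `exp (-(s * ‖x_V‖² + t * ‖x_V'‖²))`, with `V'` the
orthogonal complement of `V`, amounts to scaling both components and the total mass. -/
theorem stdGaussian_withDensity_exp (V : Submodule ℝ (E d)) {s t : ℝ} (hs : 0 ≤ s) (ht : 0 ≤ t) :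
    (stdGaussian (E d)).withDensity (fun x => ENNReal.ofReal (Real.exp
        (-(s * ‖V.starProjection x‖ ^ 2 + t * ‖Vᗮ.starProjection x‖ ^ 2)))) =
      ENNReal.ofReal (laplaceFactor s ^ Module.finrank ℝ V *
          laplaceFactor t ^ (d - Module.finrank ℝ V)) •
        (stdGaussian (E d)).map (biscale V (laplaceFactor s) (laplaceFactor t)) := by
  let v := stdOrthonormalBasis ℝ V
  let w := stdOrthonormalBasis ℝ Vᗮ
  -- In an orthonormal basis adapted to `V` and its complement, the Gaussian has independent
  -- standard coordinates and `biscale` is diagonal.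
  let b := (v.prod w).map V.orthogonalDecomposition.symm
  let G : (Fin (Module.finrank ℝ V) ⊕ Fin (Module.finrank ℝ Vᗮ) → ℝ) → E d :=
    fun z => ∑ i, z i • b i
  have hG : ∀ z, G z = ((∑ i, z (Sum.inl i) • v i : V) : E d) +
      ((∑ i, z (Sum.inr i) • w i : Vᗮ) : E d) := by
    intro z
    simp [G, b, Fintype.sum_sum_type]
  have hP : ∀ z, V.starProjection (G z) = ((∑ i, z (Sum.inl i) • v i : V) : E d) := by
    intro z
    rw [hG, map_add, Submodule.starProjection_eq_self_iff.2 (Submodule.coe_mem _),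
      (Submodule.starProjection_apply_eq_zero_iff _).2 (Submodule.coe_mem _), add_zero]
  have hQ : ∀ z, Vᗮ.starProjection (G z) = ((∑ i, z (Sum.inr i) • w i : Vᗮ) : E d) := by
    intro z
    rw [hG, map_add, Submodule.starProjection_eq_self_iff.2 (Submodule.coe_mem _),
      (Submodule.starProjection_apply_eq_zero_iff _).2
        (V.le_orthogonal_orthogonal (Submodule.coe_mem _)), zero_add]
  have hGm : Measurable G := by fun_prop
  have hfr : Module.finrank ℝ Vᗮ = d - Module.finrank ℝ V := by
    have := V.finrank_add_finrank_orthogonal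
    rw [finrank_euclideanSpace_fin] at this
    omega
  let σ : Fin (Module.finrank ℝ V) ⊕ Fin (Module.finrank ℝ Vᗮ) → ℝ :=
    Sum.elim (fun _ => s) (fun _ => t)
  have hσ : ∀ i, 0 ≤ σ i := by rintro (i | i) <;> simpa [σ]
  have hnorm : ∀ z, s * ‖V.starProjection (G z)‖ ^ 2 + t * ‖Vᗮ.starProjection (G z)‖ ^ 2 =
      ∑ i, σ i * z i ^ 2 := by
    intro z
    rw [hP, hQ, ← Submodule.coe_norm, ← Submodule.coe_norm, norm_sq_sum_smul, norm_sq_sum_smul]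
    simp [σ, Fintype.sum_sum_type, Finset.mul_sum]
  have hprod : ∏ i, laplaceFactor (σ i) = laplaceFactor s ^ Module.finrank ℝ V *
      laplaceFactor t ^ (d - Module.finrank ℝ V) := by
    simp [σ, Fintype.prod_sum_type, hfr]
  have hmap : biscale V (laplaceFactor s) (laplaceFactor t) ∘ G =
      G ∘ fun z i => laplaceFactor (σ i) * z i := by
    ext1 z
    simp only [Function.comp, biscale, hP, hQ]
    rw [hG]
    simp [σ, Finset.smul_sum, mul_smul]
  rw [stdGaussian_eq_map_pi_orthonormalBasis b]
  change (Measure.map G _).withDensity _ = _ • Measure.map _ (Measure.map G _)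
  rw [Measure.map_map (continuous_biscale _ _ _).measurable hGm, hmap,
    ← Measure.map_map hGm (by fun_prop), ← hprod, ← Measure.map_smul,
    ← pi_gaussianReal_withDensity_exp hσ]
  ext S hS
  have hmeas : Measurable fun x : E d => ENNReal.ofReal (Real.exp
        (-(s * ‖V.starProjection x‖ ^ 2 + t * ‖Vᗮ.starProjection x‖ ^ 2))) := by fun_prop
  rw [withDensity_apply _ hS, setLIntegral_map hS hmeas hGm, Measure.map_apply hGm hS,
    withDensity_apply _ (hGm hS)]
  simp_rw [hnorm]

end ConicSteiner
-- Uniqueness of the Laplace transform on the quadrant.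
namespace ConicSteiner

open BoundedContinuousFunction in
/-- The function `(x, y) ↦ exp (-(s * x + t * y))` on the quadrant. -/
noncomputable def expNeg (s t : ℝ≥0) : ℝ≥0 × ℝ≥0 →ᵇ ℝ :=
  .ofNormedAddCommGroup (fun x => Real.exp (-(s * x.1 + t * x.2))) (by fun_prop) 1 fun x => by
    rw [Real.norm_eq_abs, Real.abs_exp, Real.exp_le_one_iff, neg_nonpos]
    positivity

theorem expNeg_apply (s t : ℝ≥0) (x : ℝ≥0 × ℝ≥0) :
    expNeg s t x = Real.exp (-(s * x.1 + t * x.2)) := rfl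

theorem expNeg_nonneg (s t : ℝ≥0) (x : ℝ≥0 × ℝ≥0) : 0 ≤ expNeg s t x := (Real.exp_pos _).le

/-- The functions `expNeg s t` are closed under multiplication. -/
noncomputable def expNegSubmonoid : Submonoid (BoundedContinuousFunction (ℝ≥0 × ℝ≥0) ℝ) where
  carrier := Set.range fun p : ℝ≥0 × ℝ≥0 => expNeg p.1 p.2
  one_mem' := ⟨0, by ext x; simp [expNeg_apply]⟩
  mul_mem' := by
    rintro _ _ ⟨p, rfl⟩ ⟨q, rfl⟩
    refine ⟨p + q, ?_⟩
    ext x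
    simp only [expNeg_apply, BoundedContinuousFunction.mul_apply, ← Real.exp_add, Prod.fst_add,
      Prod.snd_add, NNReal.coe_add]
    congr 1
    ring

/-- A finite measure on the quadrant is determined by its Laplace transform. -/
theorem ext_of_integral_expNeg {P P' : Measure (ℝ≥0 × ℝ≥0)} [IsFiniteMeasure P]
    [IsFiniteMeasure P'] (h : ∀ s t : ℝ≥0, ∫ x, expNeg s t x ∂P = ∫ x, expNeg s t x ∂P') :
    P = P' := by
  -- Stone–Weierstrass: it is enough to compare integrals on a subalgebra that separates points.
  let A : StarSubalgebra ℝ (BoundedContinuousFunction (ℝ≥0 × ℝ≥0) ℝ) :=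
    { Algebra.adjoin ℝ (expNegSubmonoid : Set (BoundedContinuousFunction (ℝ≥0 × ℝ≥0) ℝ)) with
      star_mem' := by
        intro f hf
        have : star f = f := by ext x; simp
        rwa [this] }
  have hmem : ∀ s t, expNeg s t ∈ A := fun s t => Algebra.subset_adjoin ⟨(s, t), rfl⟩
  refine ext_of_forall_mem_subalgebra_integral_eq_of_polish (A := A) ?_ fun g hg => ?_
  · intro x y hxy
    have hsep : ∀ s t, expNeg s t x ≠ expNeg s t y → ∃ f ∈ ((fun f : C(ℝ≥0 × ℝ≥0, ℝ) =>
        (f : ℝ≥0 × ℝ≥0 → ℝ)) '' (A.map (BoundedContinuousFunction.toContinuousMapStarₐ ℝ) :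
          Set C(ℝ≥0 × ℝ≥0, ℝ))), f x ≠ f y := fun s t hne =>
      ⟨_, ⟨_, ⟨expNeg s t, hmem s t, rfl⟩, rfl⟩, hne⟩
    by_cases h1 : x.1 = y.1
    · have h2 : x.2 ≠ y.2 := fun h2 => hxy (Prod.ext h1 h2)
      refine hsep 0 1 ?_
      simpa [expNeg_apply] using h2
    · refine hsep 1 0 ?_
      simpa [expNeg_apply] using h1
  · have hg' : g ∈ Subalgebra.toSubmodule (Algebra.adjoin ℝ
      (expNegSubmonoid : Set (BoundedContinuousFunction (ℝ≥0 × ℝ≥0) ℝ))) := hg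
    -- The generators are closed under products, so the algebra is their linear span and linearity
    -- of the integral suffices.
    rw [Algebra.adjoin_eq_span, Submonoid.closure_eq] at hg'
    clear hg
    induction hg' using Submodule.span_induction with
    | mem f hf => obtain ⟨p, rfl⟩ := hf; exact h _ _
    | zero => simp
    | add f f' _ _ hf hf' =>
      simp only [BoundedContinuousFunction.add_apply]
      rw [integral_add (f.integrable _) (f'.integrable _),
        integral_add (f.integrable _) (f'.integrable _), hf, hf']
    | smul c f _ hf =>
      simp only [BoundedContinuousFunction.smul_apply]
      rw [integral_smul, integral_smul, hf]

end ConicSteiner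
-- Polyhedral cones: faces, active constraints and the Laplace transform.
namespace ConicSteiner

variable {d : ℕ}

/-- Scaling multiplies the projection by `a` and the residual by `b`, which preserves the conditions
of `proj_eq_of_inner`. -/
theorem proj_biscale {C : Cone d} {V : Submodule ℝ (E d)} {x : E d}
    (h : proj C x = V.starProjection x) {a b : ℝ} (ha : 0 ≤ a) (hb : 0 ≤ b) :
    proj C (biscale V a b x) = a • proj C x := by
  have hsub : biscale V a b x - a • proj C x = b • (x - proj C x) := by
    rw [biscale, Submodule.starProjection_orthogonal_val, h]
    abel
  refine proj_eq_of_inner (C.smul_mem (proj_mem C x) ha) (fun z hz => ?_) ?_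
  · rw [hsub, inner_smul_left]
    exact mul_nonpos_of_nonneg_of_nonpos hb (inner_sub_proj_le C x hz)
  · rw [hsub, inner_smul_left, inner_smul_right, inner_sub_proj_proj]
    simp

theorem biscale_biscale (V : Submodule ℝ (E d)) (a b a' b' : ℝ) (x : E d) :
    biscale V a b (biscale V a' b' x) = biscale V (a * a') (b * b') x := by
  have h1 : V.starProjection (biscale V a' b' x) = a' • V.starProjection x := by
    rw [biscale, map_add, map_smul, map_smul,
      Submodule.starProjection_eq_self_iff.2 (Submodule.starProjection_apply_mem _ _),
      (Submodule.starProjection_apply_eq_zero_iff _).2 (Submodule.starProjection_apply_mem _ _)]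
    simp
  have h2 : Vᗮ.starProjection (biscale V a' b' x) = b' • Vᗮ.starProjection x := by
    rw [Submodule.starProjection_orthogonal_val, h1, biscale]
    simp
  rw [biscale, h1, h2, smul_smul, smul_smul, biscale]

theorem biscale_one (V : Submodule ℝ (E d)) (x : E d) : biscale V 1 1 x = x := by
  rw [biscale, Submodule.starProjection_orthogonal_val]
  simp

theorem expNeg_sqNorms (s t : ℝ≥0) (C : Cone d) (x : E d) :
    expNeg s t (sqNorms C x) =
      Real.exp (-(s * ‖proj C x‖ ^ 2 + t * ‖proj (polar C) x‖ ^ 2)) := by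
  simp [expNeg_apply, sqNorms]

/-- If the projection to the cone `C` agrees with that to a subspace `V` on a set that is stable
under scaling of both components, then the Laplace transform of the squared norms on this set
is proportional to that of independent chi-square variables. -/
theorem setIntegral_expNeg_sqNorms {C : Cone d} {V : Submodule ℝ (E d)} {R : Set (E d)}
    (hR : MeasurableSet R) (hproj : ∀ x ∈ R, proj C x = V.starProjection x)
    (hscale : ∀ a b : ℝ, 0 < a → 0 < b → ∀ x ∈ R, biscale V a b x ∈ R) (s t : ℝ≥0) :
    ∫ x in R, expNeg s t (sqNorms C x) ∂stdGaussian (E d) =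
      (stdGaussian (E d)).real R * (laplaceFactor s ^ Module.finrank ℝ V *
        laplaceFactor t ^ (d - Module.finrank ℝ V)) := by
  have ha := laplaceFactor_pos s.coe_nonneg
  have hb := laplaceFactor_pos t.coe_nonneg
  -- The inverse scaling also maps `R` into itself, so `R` is its own preimage.
  have hpre : biscale V (laplaceFactor s) (laplaceFactor t) ⁻¹' R = R := by
    ext x
    refine ⟨fun hx => ?_, fun hx => hscale _ _ ha hb x hx⟩
    have := hscale _ _ (inv_pos.2 ha) (inv_pos.2 hb) _ hx
    rwa [biscale_biscale, inv_mul_cancel₀ ha.ne', inv_mul_cancel₀ hb.ne', biscale_one] at this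
  have hden := congrArg (fun μ : Measure (E d) => μ R) (stdGaussian_withDensity_exp V s.coe_nonneg t.coe_nonneg)
  simp only [Measure.smul_apply, smul_eq_mul] at hden
  rw [Measure.map_apply (continuous_biscale _ _ _).measurable hR, hpre,
    withDensity_apply _ hR] at hden
  rw [integral_eq_lintegral_of_nonneg_ae (ae_of_all _ fun x => expNeg_nonneg s t (sqNorms C x))
    ((expNeg s t).continuous.comp (continuous_sqNorms C)).aestronglyMeasurable.restrict]
  have hint : ∫⁻ x in R, ENNReal.ofReal (expNeg s t (sqNorms C x)) ∂stdGaussian (E d) =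
      ∫⁻ x in R, ENNReal.ofReal (Real.exp (-(s * ‖V.starProjection x‖ ^ 2 +
        t * ‖Vᗮ.starProjection x‖ ^ 2))) ∂stdGaussian (E d) := by
    refine setLIntegral_congr_fun hR fun x hx => ?_
    simp only [expNeg_sqNorms]
    rw [proj_polar, hproj x hx, Submodule.starProjection_orthogonal_val]
  rw [hint]
  refine (congrArg ENNReal.toReal hden).trans ?_
  rw [ENNReal.toReal_mul, ENNReal.toReal_ofReal (by positivity), mul_comm, Measure.real]

/-- The orthogonal complement of `A`, on which all the inequalities `⟪u, x⟫ ≥ 0`, `u ∈ A`, are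
equalities. -/
noncomputable def activeSpace (A : Finset (E d)) : Submodule ℝ (E d) := (Submodule.span ℝ (A : Set (E d)))ᗮ

theorem mem_activeSpace {A : Finset (E d)} {x : E d} :
    x ∈ activeSpace A ↔ ∀ u ∈ A, inner ℝ u x = 0 := by
  rw [activeSpace, Submodule.mem_orthogonal]
  refine ⟨fun h u hu => h u (Submodule.subset_span hu), fun h u hu => ?_⟩
  induction hu using Submodule.span_induction with
  | mem u hu => exact h u hu
  | zero => simp
  | add u v _ _ hu hv => rw [inner_add_left, hu, hv, add_zero]
  | smul c u _ hu => rw [inner_smul_left, hu, mul_zero]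

open Classical in
/-- The inequalities among `⟪u, x⟫ ≥ 0`, `u ∈ s`, that are equalities at `x`. -/
noncomputable def active (s : Finset (E d)) (x : E d) : Finset (E d) :=
  s.filter fun u => inner ℝ u x = 0

theorem mem_active {s : Finset (E d)} {x u : E d} :
    u ∈ active s x ↔ u ∈ s ∧ inner ℝ u x = 0 := by
  simp [active]

section Polyhedral

variable {C : Cone d} {s : Finset (E d)} (hC : (C : Set (E d)) = {x | ∀ u ∈ s, 0 ≤ inner ℝ u x})
include hC

/-- Moving along `w` leaves the active inequalities equalities, and the finitely many strict ones
survive a small move. -/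
theorem eventually_add_smul_mem {x w : E d} (hx : x ∈ C) (hw : w ∈ activeSpace (active s x)) :
    ∀ᶠ ε in 𝓝 (0 : ℝ), x + ε • w ∈ C := by
  have hmem : ∀ y, y ∈ C ↔ ∀ u ∈ s, 0 ≤ inner ℝ u y := fun y => Set.ext_iff.1 hC y
  simp_rw [hmem]
  refine (Filter.eventually_all_finset s).2 fun u hu => ?_
  rcases ((hmem x).1 hx u hu).eq_or_lt with h | h
  · refine .of_forall fun ε => ?_
    rw [inner_add_right, inner_smul_right, ← h,
      mem_activeSpace.1 hw u (mem_active.2 ⟨hu, h.symm⟩)]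
    simp
  · have hcont : Continuous fun ε : ℝ => inner ℝ u (x + ε • w) := by fun_prop
    have := hcont.tendsto 0
    simp only [zero_smul, add_zero] at this
    exact (this.eventually (lt_mem_nhds h)).mono fun _ => le_of_lt

theorem exists_add_sub_smul_mem {x w : E d} (hx : x ∈ C) (hw : w ∈ activeSpace (active s x)) :
    ∃ ε : ℝ, 0 < ε ∧ x + ε • w ∈ C ∧ x + (-ε) • w ∈ C := by
  obtain ⟨δ, hδ, h⟩ := Metric.eventually_nhds_iff.1 (eventually_add_smul_mem hC hx hw)
  refine ⟨δ / 2, half_pos hδ, h ?_, h ?_⟩ <;>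
    simp only [dist_zero_right, norm_neg, Real.norm_eq_abs] <;>
    rw [abs_of_pos (half_pos hδ)] <;> linarith

/-- Small moves from the projection in both directions `±w` stay in `C`, so the residual is
orthogonal to `w`. -/
theorem proj_eq_starProjection_activeSpace (g : E d) :
    proj C g = (activeSpace (active s (proj C g))).starProjection g := by
  refine (Submodule.eq_starProjection_of_mem_orthogonal
    (mem_activeSpace.2 fun u hu => (mem_active.1 hu).2) ?_).symm
  rw [Submodule.mem_orthogonal']
  intro w hw
  obtain ⟨ε, hε, h1, h2⟩ := exists_add_sub_smul_mem hC (proj_mem C g) hw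
  have h1 := inner_sub_proj_le C g h1
  have h2 := inner_sub_proj_le C g h2
  rw [inner_add_right, inner_sub_proj_proj, inner_smul_right] at h1 h2
  nlinarith

/-- A segment from a point `y` of the face to the relative interior point `x` can be prolonged
beyond `x` inside the face; an inequality active at `x` but strict at `y` would fail there.
Conversely, small moves `±w` stay in `C`, so the maximality of `x` forces `⟪u, w⟫ = 0` and the moved
point stays in the face. -/
theorem span_face_eq_activeSpace {u x : E d} (hx : x ∈ intrinsicInterior ℝ (face C u)) :
    Submodule.span ℝ (face C u) = activeSpace (active s x) := by
  have hmem : ∀ y, y ∈ C ↔ ∀ u ∈ s, 0 ≤ inner ℝ u y := fun y => Set.ext_iff.1 hC y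
  have hxF : x ∈ face C u := intrinsicInterior_subset hx
  apply le_antisymm
  · rw [Submodule.span_le]
    intro y hy
    obtain ⟨z, hz, rfl⟩ := mem_intrinsicInterior.1 hx
    let ℓ : ℝ → affineSpan ℝ (face C u) := fun ε =>
      ⟨AffineMap.lineMap (z : E d) y ε,
        AffineMap.lineMap_mem ε z.2 (subset_affineSpan ℝ _ hy)⟩
    have hℓ : Continuous ℓ := AffineMap.lineMap_continuous.subtype_mk _
    have h0 : ℓ 0 = z := Subtype.ext (AffineMap.lineMap_apply_zero _ _)
    have hev : ∀ᶠ ε in 𝓝 (0 : ℝ), ℓ ε ∈ ((↑) ⁻¹' face C u : Set (affineSpan ℝ (face C u))) :=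
      hℓ.continuousAt.eventually (by rw [h0]; exact mem_interior_iff_mem_nhds.1 hz)
    obtain ⟨δ, hδ, h⟩ := Metric.eventually_nhds_iff.1 hev
    -- A negative parameter gives a point on the far side of `x` from `y`.
    have hm : AffineMap.lineMap (z : E d) y (-(δ / 2)) ∈ face C u := by
      refine h (y := -(δ / 2)) ?_
      simp only [dist_zero_right, norm_neg, Real.norm_eq_abs]
      rw [abs_of_pos (half_pos hδ)]
      linarith
    refine mem_activeSpace.2 fun v hv => ?_
    obtain ⟨hvs, hv0⟩ := mem_active.1 hv
    have h1 := (hmem _).1 hm.1 v hvs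
    have h2 := (hmem _).1 hy.1 v hvs
    rw [AffineMap.lineMap_apply, vsub_eq_sub, vadd_eq_add, inner_add_right, inner_smul_right,
      inner_sub_right, hv0] at h1
    nlinarith
  · intro w hw
    obtain ⟨ε, hε, h1, h2⟩ := exists_add_sub_smul_mem hC hxF.1 hw
    have h3 := hxF.2 _ h1
    have h4 := hxF.2 _ h2
    rw [inner_add_right, inner_smul_right] at h3 h4
    have h5 : inner ℝ u w = 0 := by nlinarith
    have h6 : x + ε • w ∈ face C u :=
      ⟨h1, fun y hy => by
        rw [inner_add_right, inner_smul_right, h5, mul_zero, add_zero]; exact hxF.2 y hy⟩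
    have h7 : w = ε⁻¹ • ((x + ε • w) - x) := by
      rw [add_sub_cancel_left, smul_smul, inv_mul_cancel₀ hε.ne', one_smul]
    rw [h7]
    exact Submodule.smul_mem _ _ (Submodule.sub_mem _ (Submodule.subset_span h6)
      (Submodule.subset_span hxF))

theorem exists_mem_intrinsicInterior_face {x : E d} (hx : x ∈ C) :
    ∃ u, x ∈ intrinsicInterior ℝ (face C u) := by
  have hmem : ∀ y, y ∈ C ↔ ∀ u ∈ s, 0 ≤ inner ℝ u y := fun y => Set.ext_iff.1 hC y
  -- Each summand of `⟪u, ·⟫` is nonpositive on `C`, so the maximum `0` is attained exactly where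
  -- all inequalities active at `x` are equalities. In this face `x` is relatively interior, since
  -- the other inequalities are strict at `x`.
  let u : E d := -∑ a ∈ active s x, a
  have hu : ∀ y, inner ℝ u y = -∑ a ∈ active s x, inner ℝ a y := fun y => by
    rw [inner_neg_left, sum_inner]
  have hle : ∀ y ∈ C, inner ℝ u y ≤ 0 := fun y hy => by
    rw [hu, neg_nonpos]
    exact Finset.sum_nonneg fun a ha => (hmem y).1 hy a (mem_active.1 ha).1
  have hzero : ∀ y ∈ activeSpace (active s x), inner ℝ u y = 0 := fun y hy => by
    rw [hu, Finset.sum_eq_zero (mem_activeSpace.1 hy), neg_zero]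
  have hxV : x ∈ activeSpace (active s x) := mem_activeSpace.2 fun a ha => (mem_active.1 ha).2
  have hface : ∀ y ∈ C, y ∈ activeSpace (active s x) → y ∈ face C u := fun y hy hyV =>
    ⟨hy, fun z hz => (hle z hz).trans_eq (hzero y hyV).symm⟩
  have hsub : face C u ⊆ activeSpace (active s x) := by
    intro y hy
    have h1 := hy.2 x hx
    rw [hzero x hxV, hu] at h1
    have h2 : ∀ a ∈ active s x, 0 ≤ inner ℝ a y := fun a ha =>
      (hmem y).1 hy.1 a (mem_active.1 ha).1
    exact mem_activeSpace.2 ((Finset.sum_eq_zero_iff_of_nonneg h2).1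
      (le_antisymm (by linarith) (Finset.sum_nonneg h2)))
  have hspan : affineSpan ℝ (face C u) ≤ (activeSpace (active s x)).toAffineSubspace :=
    affineSpan_le.2 hsub
  have hxF := hface x hx hxV
  refine ⟨u, mem_intrinsicInterior.2 ⟨⟨x, subset_affineSpan ℝ _ hxF⟩, ?_, rfl⟩⟩
  rw [mem_interior_iff_mem_nhds]
  have hev : ∀ᶠ z : affineSpan ℝ (face C u) in 𝓝 ⟨x, subset_affineSpan ℝ _ hxF⟩,
      ∀ a ∈ s, inner ℝ a x ≠ 0 → 0 < inner ℝ a (z : E d) := by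
    refine (Filter.eventually_all_finset s).2 fun a ha => ?_
    by_cases h0 : inner ℝ a x = 0
    · exact .of_forall fun z h => (h h0).elim
    · have hcont : Continuous fun z : affineSpan ℝ (face C u) => inner ℝ a (z : E d) := by fun_prop
      have hpos : 0 < inner ℝ a x := lt_of_le_of_ne ((hmem x).1 hx a ha) (Ne.symm h0)
      exact (hcont.continuousAt.eventually (lt_mem_nhds hpos)).mono fun z hz _ => hz
  filter_upwards [hev] with z hz
  have hzV : (z : E d) ∈ activeSpace (active s x) := hspan z.2
  refine hface z ((hmem _).2 fun a ha => ?_) hzV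
  by_cases h0 : inner ℝ a x = 0
  · exact (mem_activeSpace.1 hzV a (mem_active.2 ⟨ha, h0⟩)).ge
  · exact (hz a ha h0).le

/-- Trades faces for active sets, which are finitely many and partition the space into measurable
pieces. -/
theorem polyhedralVolume_eq_measureReal_active (k : ℕ) :
    polyhedralVolume C k = (stdGaussian (E d)).real
      {g | Module.finrank ℝ (activeSpace (active s (proj C g))) = k} := by
  rw [polyhedralVolume]
  congr 1
  ext g
  constructor
  · rintro ⟨u, hk, hu⟩
    rw [dimHull, span_face_eq_activeSpace hC hu] at hk
    exact hk
  · intro hk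
    obtain ⟨u, hu⟩ := exists_mem_intrinsicInterior_face hC (proj_mem C g)
    refine ⟨u, ?_, hu⟩
    rw [dimHull, span_face_eq_activeSpace hC hu]
    exact hk

omit hC in
theorem measurableSet_active_proj_eq (C : Cone d) (s A : Finset (E d)) :
    MeasurableSet {g | active s (proj C g) = A} := by
  have h : {g | active s (proj C g) = A} =
      {_g | A ⊆ s} ∩ ⋂ u ∈ s, {g | inner ℝ u (proj C g) = 0 ↔ u ∈ A} := by
    ext g
    simp only [Set.mem_ofPred_eq, Set.mem_inter_iff, Set.mem_iInter]
    constructor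
    · rintro rfl
      exact ⟨fun u hu => (mem_active.1 hu).1, fun u hu => by simp [mem_active, hu]⟩
    · rintro ⟨hA, h⟩
      ext u
      rw [mem_active]
      exact ⟨fun hu => (h u hu.1).1 hu.2, fun hu => ⟨hA hu, (h u (hA hu)).2 hu⟩⟩
  rw [h]
  refine (MeasurableSet.const _).inter (s.measurableSet_biInter fun u _ => ?_)
  have hcont : Continuous fun g => inner ℝ u (proj C g) :=
    continuous_const.inner (continuous_proj C)
  have hm : MeasurableSet {g | inner ℝ u (proj C g) = 0} :=
    hcont.measurable (measurableSet_singleton 0)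
  by_cases hu : u ∈ A
  · simpa [hu] using hm
  · simp only [hu, iff_false]
    exact hm.compl

theorem polyhedralVolume_eq_sum (k : ℕ) :
    polyhedralVolume C k = ∑ A ∈ s.powerset, if Module.finrank ℝ (activeSpace A) = k then
      (stdGaussian (E d)).real {g | active s (proj C g) = A} else 0 := by
  rw [polyhedralVolume_eq_measureReal_active hC, ← Finset.sum_filter,
    ← measureReal_biUnion_finset _ fun A _ => measurableSet_active_proj_eq C s A]
  · congr 1
    ext g
    simp only [Set.mem_ofPred_eq, Set.mem_iUnion, Finset.mem_filter, Finset.mem_powerset,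
      exists_prop]
    constructor
    · exact fun h => ⟨_, ⟨fun u hu => (mem_active.1 hu).1, h⟩, rfl⟩
    · rintro ⟨A, ⟨-, h⟩, rfl⟩
      exact h
  · intro A _ B _ hAB
    exact Set.disjoint_left.2 fun g hA hB => hAB (hA.symm.trans hB)

theorem setIntegral_active_proj_eq (A : Finset (E d)) (a b : ℝ≥0) :
    ∫ x in {g | active s (proj C g) = A}, expNeg a b (sqNorms C x) ∂stdGaussian (E d) =
      (stdGaussian (E d)).real {g | active s (proj C g) = A} *
        (laplaceFactor a ^ Module.finrank ℝ (activeSpace A) *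
          laplaceFactor b ^ (d - Module.finrank ℝ (activeSpace A))) := by
  have hproj : ∀ x ∈ {g | active s (proj C g) = A},
      proj C x = (activeSpace A).starProjection x := by
    rintro x rfl
    exact proj_eq_starProjection_activeSpace hC x
  refine setIntegral_expNeg_sqNorms (measurableSet_active_proj_eq C s A) hproj
    (fun r q hr hq x hx => ?_) a b
  rw [Set.mem_ofPred_eq, proj_biscale (hproj x hx) hr.le hq.le]
  refine Eq.trans ?_ hx
  ext u
  simp [mem_active, inner_smul_right, hr.ne']

theorem integral_expNeg_sqNorms_of_eq (a b : ℝ≥0) :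
    ∫ x, expNeg a b (sqNorms C x) ∂stdGaussian (E d) =
      ∑ k : Fin (d + 1), polyhedralVolume C k *
        (laplaceFactor a ^ (k : ℕ) * laplaceFactor b ^ (d - k)) := by
  have hU : ⋃ A ∈ s.powerset, {g | active s (proj C g) = A} = Set.univ := by
    refine Set.eq_univ_of_forall fun g => ?_
    simp only [Set.mem_iUnion, Finset.mem_powerset, exists_prop]
    exact ⟨_, fun u hu => (mem_active.1 hu).1, rfl⟩
  have hint : Integrable (fun x => expNeg a b (sqNorms C x)) (stdGaussian (E d)) :=
    ((expNeg a b).integrable _).comp_measurable (measurable_sqNorms C)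
  rw [← setIntegral_univ, ← hU, integral_biUnion_finset _
    (fun A _ => measurableSet_active_proj_eq C s A)
    (fun A _ B _ hAB => Set.disjoint_left.2 fun g hA hB => hAB (hA.symm.trans hB))
    (fun A _ => hint.integrableOn)]
  simp_rw [setIntegral_active_proj_eq hC, polyhedralVolume_eq_sum hC, Finset.sum_mul]
  rw [Finset.sum_comm]
  refine Finset.sum_congr rfl fun A _ => ?_
  have hlt : Module.finrank ℝ (activeSpace A) < d + 1 :=
    Nat.lt_succ_of_le ((Submodule.finrank_le _).trans_eq finrank_euclideanSpace_fin)
  rw [Finset.sum_eq_single (⟨_, hlt⟩ : Fin (d + 1)) (fun k _ hk => ?_) (by simp)]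
  · simp
  · rw [if_neg fun h => hk (Fin.ext h.symm), zero_mul]

end Polyhedral

theorem integral_expNeg_sqNorms {C : Cone d} (hC : IsPolyhedral C) (a b : ℝ≥0) :
    ∫ x, expNeg a b (sqNorms C x) ∂stdGaussian (E d) =
      ∑ k : Fin (d + 1), polyhedralVolume C k *
        (laplaceFactor a ^ (k : ℕ) * laplaceFactor b ^ (d - k)) :=
  integral_expNeg_sqNorms_of_eq hC.choose_spec a b

end ConicSteiner
-- Conic Hausdorff metric: continuity of the projection and polyhedral approximation.
namespace ConicSteiner

variable {d : ℕ}

theorem exists_norm_sub_le_of_mem_angExpansion {C : Cone d} {α : ℝ} {x : E d}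
    (hx : x ∈ angExpansion C α) : ∃ z ∈ C, ‖x - z‖ ≤ α * ‖x‖ := by
  obtain ⟨y, hy, hα⟩ := hx
  by_cases hx0 : x = 0
  · exact ⟨0, C.zero_mem, by simp [hx0]⟩
  rw [angDist, if_neg fun h => hx0 h.1] at hα
  by_cases hy0 : y = 0
  · refine ⟨0, C.zero_mem, ?_⟩
    rw [hy0, InnerProductGeometry.angle_zero_right] at hα
    -- The angle with the zero vector is `π / 2`, which exceeds `1`, so the origin is close enough.
    have h1 : 1 ≤ α := by linarith [Real.pi_gt_three]
    rw [sub_zero]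
    exact le_mul_of_one_le_left (norm_nonneg _) h1
  · have hxn : 0 < ‖x‖ := norm_pos_iff.2 hx0
    have hyn : 0 < ‖y‖ := norm_pos_iff.2 hy0
    have hθ := InnerProductGeometry.angle_nonneg x y
    -- With `y` rescaled to the length of `x`, the chord satisfies `‖x - z‖² = 2‖x‖²(1 - cos θ) ≤
    -- θ²‖x‖²`.
    refine ⟨(‖x‖ / ‖y‖) • y, C.smul_mem hy (by positivity), ?_⟩
    refine le_trans (abs_le_of_sq_le_sq' ?_ (by positivity)).2
      (mul_le_mul_of_nonneg_right hα hxn.le)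
    have hcos := InnerProductGeometry.cos_angle_mul_norm_mul_norm x y
    have hle := Real.one_sub_sq_div_two_le_cos (x := InnerProductGeometry.angle x y)
    rw [norm_sub_sq_real, inner_smul_right, ← hcos, norm_smul, Real.norm_eq_abs,
      abs_of_pos (by positivity), div_mul_cancel₀ _ hyn.ne']
    have h2 : ‖x‖ / ‖y‖ * (Real.cos (InnerProductGeometry.angle x y) * (‖x‖ * ‖y‖)) =
        Real.cos (InnerProductGeometry.angle x y) * ‖x‖ ^ 2 := by
      field_simp
    rw [h2, mul_pow]
    nlinarith [sq_nonneg ‖x‖]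

/-- A point `q` of `C` near `proj K x` is at most `2α‖x‖` farther from `x` than `proj C x` is. The
obtuse angle at `proj C x` bounds `‖q - proj C x‖²` by the difference of the squared distances,
hence the square root. -/
theorem norm_proj_sub_proj_le_of_subset_angExpansion {K C : Cone d} {α : ℝ} (hα : 0 ≤ α)
    (hK : (K : Set (E d)) ⊆ angExpansion C α) (hC : (C : Set (E d)) ⊆ angExpansion K α)
    (x : E d) : ‖proj K x - proj C x‖ ≤ α * ‖x‖ + √(4 * α * (1 + α) * ‖x‖ ^ 2) := by
  obtain ⟨q, hq, hq'⟩ := exists_norm_sub_le_of_mem_angExpansion (hK (proj_mem K x))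
  obtain ⟨r, hr, hr'⟩ := exists_norm_sub_le_of_mem_angExpansion (hC (proj_mem C x))
  have h1 := mul_le_mul_of_nonneg_left (norm_proj_le K x) hα
  have h2 := mul_le_mul_of_nonneg_left (norm_proj_le C x) hα
  have h3 := norm_sub_proj_le K x hr
  have h4 : ‖x - r‖ ≤ ‖x - proj C x‖ + ‖proj C x - r‖ := norm_sub_le_norm_sub_add_norm_sub _ _ _
  have h5 : ‖x - q‖ ≤ ‖x - proj K x‖ + ‖proj K x - q‖ := norm_sub_le_norm_sub_add_norm_sub _ _ _
  have h6 : ‖x - proj C x‖ ≤ ‖x‖ := by simpa using norm_sub_proj_le C x C.zero_mem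
  have h7 := inner_sub_proj_sub_le C x hq
  have h8 : ‖x - q‖ ^ 2 = ‖x - proj C x‖ ^ 2 - 2 * inner ℝ (x - proj C x) (q - proj C x) +
      ‖q - proj C x‖ ^ 2 := by
    rw [← norm_sub_sq_real]
    congr 2
    abel
  have h9 : ‖x - q‖ ≤ ‖x - proj C x‖ + 2 * (α * ‖x‖) := by linarith
  have h10 : ‖q - proj C x‖ ^ 2 ≤ 4 * α * (1 + α) * ‖x‖ ^ 2 := by
    have h11 := pow_le_pow_left₀ (norm_nonneg _) h9 2
    have h12 : α * ‖x‖ * ‖x - proj C x‖ ≤ α * ‖x‖ * ‖x‖ :=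
      mul_le_mul_of_nonneg_left h6 (by positivity)
    nlinarith
  calc ‖proj K x - proj C x‖ ≤ ‖proj K x - q‖ + ‖q - proj C x‖ :=
        norm_sub_le_norm_sub_add_norm_sub _ _ _
    _ ≤ _ := add_le_add (hq'.trans h1) (Real.le_sqrt_of_sq_le h10)

theorem angExpansion_mono (C : Cone d) {α β : ℝ} (h : α ≤ β) :
    angExpansion C α ⊆ angExpansion C β :=
  fun _ ⟨y, hy, hα⟩ => ⟨y, hy, hα.trans h⟩

theorem angDist_le_pi (x y : E d) : angDist x y ≤ Real.pi := by
  unfold angDist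
  split_ifs
  · exact Real.pi_pos.le
  · exact InnerProductGeometry.angle_le_pi x y

theorem subset_angExpansion_of_hausDist_lt {K C : Cone d} {α : ℝ} (h : hausDist K C < α) :
    (K : Set (E d)) ⊆ angExpansion C α ∧ (C : Set (E d)) ⊆ angExpansion K α := by
  -- The angle `π` is always admissible, so the infimum is not the default value at the empty set.
  have hne : {α : ℝ | 0 ≤ α ∧ (C : Set (E d)) ⊆ angExpansion K α ∧
      (K : Set (E d)) ⊆ angExpansion C α}.Nonempty :=
    ⟨Real.pi, Real.pi_pos.le, fun _ _ => ⟨0, K.zero_mem, angDist_le_pi _ _⟩,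
      fun _ _ => ⟨0, C.zero_mem, angDist_le_pi _ _⟩⟩
  obtain ⟨β, ⟨-, h1, h2⟩, hβ⟩ := exists_lt_of_csInf_lt hne h
  exact ⟨h2.trans (angExpansion_mono C hβ.le), h1.trans (angExpansion_mono K hβ.le)⟩

/-- The metric projection depends continuously on the cone. -/
theorem tendsto_proj {K : ℕ → Cone d} {C : Cone d}
    (h : Tendsto (fun i => hausDist (K i) C) atTop (𝓝 0)) (x : E d) :
    Tendsto (fun i => proj (K i) x) atTop (𝓝 (proj C x)) := by
  have hcont : Continuous fun α : ℝ => α * ‖x‖ + √(4 * α * (1 + α) * ‖x‖ ^ 2) := by fun_prop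
  have h0 : Tendsto (fun α : ℝ => α * ‖x‖ + √(4 * α * (1 + α) * ‖x‖ ^ 2)) (𝓝[>] 0) (𝓝 0) := by
    have := hcont.tendsto 0
    simp only [zero_mul, mul_zero, Real.sqrt_zero, add_zero] at this
    exact this.mono_left nhdsWithin_le_nhds
  rw [Metric.tendsto_nhds]
  intro ε hε
  obtain ⟨α, hα, hlt⟩ := ((h0.eventually (gt_mem_nhds hε)).and self_mem_nhdsWithin).exists
  filter_upwards [h.eventually (gt_mem_nhds (show (0 : ℝ) < α from hlt))] with i hi
  obtain ⟨h1, h2⟩ := subset_angExpansion_of_hausDist_lt hi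
  rw [dist_eq_norm]
  exact (norm_proj_sub_proj_le_of_subset_angExpansion (le_of_lt hlt) h1 h2 x).trans_lt hα

theorem tendsto_sqNorms {K : ℕ → Cone d} {C : Cone d}
    (h : Tendsto (fun i => hausDist (K i) C) atTop (𝓝 0)) (x : E d) :
    Tendsto (fun i => sqNorms (K i) x) atTop (𝓝 (sqNorms C x)) := by
  have h1 := tendsto_proj h x
  refine ((h1.nnnorm.pow 2)).prodMk_nhds ?_
  simp_rw [proj_polar]
  exact (tendsto_const_nhds.sub h1).nnnorm.pow 2

theorem hausDist_nonneg (K C : Cone d) : 0 ≤ hausDist K C :=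
  Real.sInf_nonneg fun _ h => h.1

/-- A closed convex cone is contained in polyhedral cones that are arbitrarily close to it. -/
theorem exists_isPolyhedral_hausDist_le (C : Cone d) {ε : ℝ} (hε : 0 < ε) :
    ∃ K : Cone d, IsPolyhedral K ∧ hausDist K C ≤ ε := by
  -- The unit vectors at angle at least `ε` from all of `C`; the factor `1` is `‖x‖`. This set is
  -- compact and misses `C`, so finitely many halfspaces containing `C` exclude it. They cut out the
  -- approximating cone.
  let T : Set (E d) := Metric.sphere 0 1 ∩
    ⋂ y ∈ C, {x | ε ≤ Real.arccos (inner ℝ x y / (1 * ‖y‖))}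
  have hTc : IsCompact T := by
    refine (isCompact_sphere 0 1).inter_right (isClosed_biInter fun y _ => ?_)
    exact isClosed_le continuous_const
      (Real.continuous_arccos.comp ((continuous_id.inner continuous_const).div_const _))
  have hTC : ∀ x ∈ T, x ∉ C := by
    rintro x ⟨hx1, hx2⟩ hxC
    have hx1 : ‖x‖ = 1 := by simpa using hx1
    have := Set.mem_iInter₂.1 hx2 x hxC
    rw [Set.mem_ofPred_eq, real_inner_self_eq_norm_sq, hx1] at this
    simp at this
    linarith
  choose! u hu hux using fun x (hx : x ∈ T) => C.hyperplane_separation' (hTC x hx)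
  obtain ⟨t, htT, hcov⟩ := hTc.elim_nhds_subcover (fun x => {y | inner ℝ y (u x) < 0})
    fun x hx => (isOpen_lt (continuous_id.inner continuous_const) continuous_const).mem_nhds
      (hux x hx)
  classical
  let s := t.image u
  refine ⟨ProperCone.innerDual (s : Set (E d)), ⟨s, ?_⟩, ?_⟩
  · ext y
    simp
  -- The new cone contains `C`, so one inclusion costs no angle. For the other, a normalised point
  -- of the new cone lies outside `T`, hence within `ε` of `C`.
  refine csInf_le ⟨0, fun _ h => h.1⟩ ⟨hε.le, fun x hx => ⟨x, ?_, ?_⟩, fun x hx => ?_⟩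
  · rw [ProperCone.mem_innerDual]
    intro v hv
    obtain ⟨z, hz, rfl⟩ := Finset.mem_image.1 (Finset.mem_coe.1 hv)
    rw [real_inner_comm]
    exact hu z (htT z hz) x hx
  · by_cases h0 : x = 0
    · simp [angDist, h0, hε.le]
    · rw [angDist, if_neg fun h => h0 h.1, InnerProductGeometry.angle_self h0]
      exact hε.le
  · by_cases h0 : x = 0
    · exact ⟨0, C.zero_mem, by simp [angDist, h0, hε.le]⟩
    have hxn : 0 < ‖x‖ := norm_pos_iff.2 h0
    have hnT : ‖x‖⁻¹ • x ∉ T := by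
      intro hT
      obtain ⟨z, hz, hlt⟩ := Set.mem_iUnion₂.1 (hcov hT)
      rw [Set.mem_ofPred_eq, inner_smul_left, real_inner_comm] at hlt
      have hge : 0 ≤ inner ℝ (u z) x := ProperCone.mem_innerDual.1 hx
        (Finset.mem_coe.2 (Finset.mem_image_of_mem u hz))
      have : 0 ≤ ‖x‖⁻¹ * inner ℝ (u z) x := by positivity
      exact absurd hlt (not_lt.2 this)
    have hns : ‖x‖⁻¹ • x ∈ Metric.sphere (0 : E d) 1 := by
      simp [norm_smul, hxn.ne']
    have : ∃ y ∈ C, Real.arccos (inner ℝ (‖x‖⁻¹ • x) y / (1 * ‖y‖)) < ε := by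
      by_contra! hcon
      exact hnT ⟨hns, Set.mem_iInter₂.2 hcon⟩
    obtain ⟨y, hy, hlt⟩ := this
    refine ⟨y, hy, ?_⟩
    rw [angDist, if_neg fun h => h0 h.1, InnerProductGeometry.angle]
    refine le_of_eq_of_le ?_ hlt.le
    congr 1
    rw [inner_smul_left, one_mul, RCLike.conj_to_real, mul_comm ‖x‖⁻¹, ← div_eq_mul_inv, div_div]

theorem exists_polyhedralApprox (C : Cone d) : ∃ K : ℕ → Cone d, PolyhedralApprox K C := by
  choose K hK hle using fun n : ℕ =>
    exists_isPolyhedral_hausDist_le C (Nat.one_div_pos_of_nat (α := ℝ) (n := n))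
  exact ⟨K, hK, squeeze_zero (fun _ => hausDist_nonneg _ _) hle
    tendsto_one_div_add_atTop_nhds_zero_nat⟩

end ConicSteiner
-- Intrinsic volumes of general cones and the mixture law.
namespace ConicSteiner

variable {d : ℕ}

instance (k : ℕ) : IsProbabilityMeasure (chiSquare k) :=
  Measure.isProbabilityMeasure_map (Measurable.aemeasurable (by fun_prop))

/-- This is the total mass in `pi_gaussianReal_withDensity_exp`. -/
theorem integral_exp_neg_mul_chiSquare (s : ℝ≥0) (k : ℕ) :
    ∫ x : ℝ≥0, Real.exp (-(s * x)) ∂chiSquare k = laplaceFactor s ^ k := by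
  rw [chiSquare, integral_map (Measurable.aemeasurable (by fun_prop))
    (Continuous.aestronglyMeasurable (by fun_prop : Continuous fun x : ℝ≥0 => Real.exp (-(s * x))))]
  have h := congrArg (fun μ : Measure (Fin k → ℝ) => μ Set.univ)
    (pi_gaussianReal_withDensity_exp (ι := Fin k) (σ := fun _ => s) fun _ => s.coe_nonneg)
  have hp : IsProbabilityMeasure ((Measure.pi fun _ : Fin k => gaussianReal 0 1).map
      (fun z i => laplaceFactor s * z i)) := Measure.isProbabilityMeasure_map (Measurable.aemeasurable (by fun_prop))
  simp only [Measure.smul_apply, smul_eq_mul, withDensity_apply _ MeasurableSet.univ,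
    Measure.restrict_univ, measure_univ, mul_one, Finset.prod_const, Finset.card_univ,
    Fintype.card_fin] at h
  have hpos := laplaceFactor_pos s.coe_nonneg
  rw [integral_eq_lintegral_of_nonneg_ae (ae_of_all _ fun x => (Real.exp_pos _).le)
    (Continuous.aestronglyMeasurable (by fun_prop))]
  rw [← ENNReal.toReal_ofReal (pow_nonneg hpos.le k), ← h]
  simp [Finset.mul_sum]

theorem integral_expNeg_chiSquare_prod (s t : ℝ≥0) (j k : ℕ) :
    ∫ x, expNeg s t x ∂(chiSquare j).prod (chiSquare k) =
      laplaceFactor s ^ j * laplaceFactor t ^ k := by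
  rw [← integral_exp_neg_mul_chiSquare, ← integral_exp_neg_mul_chiSquare, ← integral_prod_mul]
  simp_rw [expNeg_apply, neg_add, Real.exp_add]

/-- The nodes at which the generating polynomial of the intrinsic volumes is evaluated. -/
noncomputable def volumeMatrix (d : ℕ) : Matrix (Fin (d + 1)) (Fin (d + 1)) ℝ :=
  Matrix.vandermonde fun j => laplaceFactor (j : ℕ)

/-- The nodes are distinct because `laplaceFactor` is injective on nonnegative reals. -/
theorem isUnit_det_volumeMatrix (d : ℕ) : IsUnit (volumeMatrix d).det := by
  rw [isUnit_iff_ne_zero, volumeMatrix, Matrix.det_vandermonde_ne_zero_iff]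
  intro i j h
  simp only [laplaceFactor, inv_inj] at h
  rw [Real.sqrt_inj (by positivity) (by positivity)] at h
  have : ((i : ℕ) : ℝ) = (j : ℕ) := by linarith
  exact Fin.ext (Nat.cast_injective this)

/-- The Laplace transform of `‖Π_C(g)‖²` at the nodes. -/
noncomputable def nodeValues (C : Cone d) (j : Fin (d + 1)) : ℝ :=
  ∫ x, expNeg (j : ℕ) 0 (sqNorms C x) ∂stdGaussian (E d)

/-- The right-hand side makes sense for every cone and is continuous in it; this yields the limits.
-/
theorem polyhedralVolume_eq_mulVec {C : Cone d} (hC : IsPolyhedral C) :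
    (fun k : Fin (d + 1) => polyhedralVolume C k) =
      Matrix.mulVec (volumeMatrix d)⁻¹ (nodeValues C) := by
  have h : nodeValues C =
      Matrix.mulVec (volumeMatrix d) (fun k : Fin (d + 1) => polyhedralVolume C k) := by
    ext j
    rw [nodeValues, integral_expNeg_sqNorms hC]
    simp [Matrix.mulVec, dotProduct, volumeMatrix, Matrix.vandermonde_apply, laplaceFactor_zero,
      mul_comm]
  rw [h, Matrix.mulVec_mulVec, Matrix.nonsing_inv_mul _ (isUnit_det_volumeMatrix d),
    Matrix.one_mulVec]

theorem tendsto_integral_expNeg_sqNorms {K : ℕ → Cone d} {C : Cone d}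
    (h : PolyhedralApprox K C) (s t : ℝ≥0) :
    Tendsto (fun i => ∫ x, expNeg s t (sqNorms (K i) x) ∂stdGaussian (E d)) atTop
      (𝓝 (∫ x, expNeg s t (sqNorms C x) ∂stdGaussian (E d))) :=
  tendsto_integral_of_dominated_convergence (fun _ => ‖expNeg s t‖)
    (fun i => ((expNeg s t).continuous.comp (continuous_sqNorms (K i))).aestronglyMeasurable)
    (integrable_const _) (fun _ => ae_of_all _ fun _ => (expNeg s t).norm_coe_le_norm _)
    (ae_of_all _ fun x => ((expNeg s t).continuous.tendsto _).comp (tendsto_sqNorms h.2 x))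

theorem tendsto_polyhedralVolume_mulVec {K : ℕ → Cone d} {C : Cone d}
    (h : PolyhedralApprox K C) (k : Fin (d + 1)) :
    Tendsto (fun i => polyhedralVolume (K i) k) atTop
      (𝓝 (Matrix.mulVec (volumeMatrix d)⁻¹ (nodeValues C) k)) := by
  have h1 : ∀ i, polyhedralVolume (K i) k =
      ∑ j, (volumeMatrix d)⁻¹ k j * nodeValues (K i) j := fun i =>
    congrFun (polyhedralVolume_eq_mulVec (h.1 i)) k
  simp_rw [h1]
  exact tendsto_finsetSum _ fun j _ =>
    (tendsto_integral_expNeg_sqNorms h (j : ℕ) 0).const_mul _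

theorem tendsto_polyhedralVolume {K : ℕ → Cone d} {C : Cone d}
    (h : PolyhedralApprox K C) (k : Fin (d + 1)) :
    Tendsto (fun i => polyhedralVolume (K i) k) atTop (𝓝 (intrinsicVolume C k)) :=
  -- The limit found from `nodeValues C` is the same for all approximating sequences, so it
  -- witnesses the property defining `intrinsicVolume`.
  Classical.epsilon_spec (p := fun v : ℝ => ∀ K : ℕ → Cone d, PolyhedralApprox K C →
    Tendsto (fun i => polyhedralVolume (K i) k) atTop (𝓝 v))
    ⟨_, fun _ hK => tendsto_polyhedralVolume_mulVec hK k⟩ K h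

theorem intrinsicVolume_nonneg (C : Cone d) (k : Fin (d + 1)) : 0 ≤ intrinsicVolume C k := by
  obtain ⟨K, hK⟩ := exists_polyhedralApprox C
  exact ge_of_tendsto' (tendsto_polyhedralVolume hK k) fun _ => measureReal_nonneg

/-- The Laplace transform of the squared norms of the two projections of a Gaussian vector. -/
theorem integral_expNeg_sqNorms_eq_sum (C : Cone d) (s t : ℝ≥0) :
    ∫ x, expNeg s t (sqNorms C x) ∂stdGaussian (E d) =
      ∑ k : Fin (d + 1), intrinsicVolume C k *
        (laplaceFactor s ^ (k : ℕ) * laplaceFactor t ^ (d - k)) := by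
  obtain ⟨K, hK⟩ := exists_polyhedralApprox C
  refine tendsto_nhds_unique (tendsto_integral_expNeg_sqNorms hK s t) ?_
  simp_rw [fun i => integral_expNeg_sqNorms (hK.1 i)]
  exact tendsto_finsetSum _ fun k _ => (tendsto_polyhedralVolume hK k).mul_const _

theorem sum_intrinsicVolume (C : Cone d) : ∑ k : Fin (d + 1), intrinsicVolume C k = 1 := by
  have h := integral_expNeg_sqNorms_eq_sum C 0 0
  simpa [expNeg_apply, laplaceFactor_zero] using h.symm

theorem rev_eq_sub (k : Fin (d + 1)) : (k.rev : ℕ) = d - k := by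
  rw [Fin.val_rev]
  omega

/-- The law of the squared norms of the two projections is a mixture of laws of pairs of
independent chi-square variables, weighted by the intrinsic volumes. -/
theorem map_sqNorms_stdGaussian (C : Cone d) :
    (stdGaussian (E d)).map (sqNorms C) = ∑ k : Fin (d + 1),
      ENNReal.ofReal (intrinsicVolume C k) • (chiSquare k).prod (chiSquare k.rev) := by
  have hfin : ∀ k : Fin (d + 1), IsFiniteMeasure
      (ENNReal.ofReal (intrinsicVolume C k) • (chiSquare k).prod (chiSquare k.rev)) := fun k =>
    Measure.smul_finite _ ENNReal.ofReal_ne_top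
  have hmap : IsProbabilityMeasure ((stdGaussian (E d)).map (sqNorms C)) :=
    Measure.isProbabilityMeasure_map (measurable_sqNorms C).aemeasurable
  refine ext_of_integral_expNeg fun s t => ?_
  rw [integral_map (measurable_sqNorms C).aemeasurable
    (expNeg s t).continuous.aestronglyMeasurable, integral_expNeg_sqNorms_eq_sum,
    integral_finsetSum_measure fun k _ => (expNeg s t).integrable _]
  refine Finset.sum_congr rfl fun k _ => ?_
  rw [integral_smul_measure, integral_expNeg_chiSquare_prod, rev_eq_sub,
    ENNReal.toReal_ofReal (intrinsicVolume_nonneg C k), smul_eq_mul]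

theorem proj_subspaceCone (L : Submodule ℝ (E d)) (x : E d) :
    proj (subspaceCone L) x = L.starProjection x := by
  refine proj_eq_of_inner (L.starProjection_apply_mem x) (fun z hz => ?_) ?_
  · exact (L.starProjection_inner_eq_zero x z hz).le
  · exact L.starProjection_inner_eq_zero x _ (L.starProjection_apply_mem x)

/-- Here the whole space is a single scaling-stable piece, with `V = L`. -/
theorem map_sqNorms_subspaceCone (L : Submodule ℝ (E d)) :
    (stdGaussian (E d)).map (sqNorms (subspaceCone L)) =
      (chiSquare (Module.finrank ℝ L)).prod (chiSquare (d - Module.finrank ℝ L)) := by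
  have hmap : IsProbabilityMeasure ((stdGaussian (E d)).map (sqNorms (subspaceCone L))) :=
    Measure.isProbabilityMeasure_map (measurable_sqNorms _).aemeasurable
  refine ext_of_integral_expNeg fun s t => ?_
  rw [integral_map (measurable_sqNorms _).aemeasurable
    (expNeg s t).continuous.aestronglyMeasurable, integral_expNeg_chiSquare_prod,
    ← setIntegral_univ, setIntegral_expNeg_sqNorms MeasurableSet.univ
      (fun x _ => proj_subspaceCone L x) (fun _ _ _ _ _ _ => trivial)]
  simp

theorem phi_eq_sum_integral_chiSquare (C : Cone d) {f : ℝ≥0 × ℝ≥0 → ℝ} (hf : Measurable f)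
    (hint : ∀ k : Fin (d + 1), Integrable f ((chiSquare k).prod (chiSquare k.rev))) :
    phi f C = ∑ k : Fin (d + 1),
      (∫ x, f x ∂(chiSquare k).prod (chiSquare k.rev)) * intrinsicVolume C k := by
  rw [phi, ← integral_map (measurable_sqNorms C).aemeasurable hf.aestronglyMeasurable,
    map_sqNorms_stdGaussian, integral_finsetSum_measure fun k _ =>
      (hint k).smul_measure ENNReal.ofReal_ne_top]
  refine Finset.sum_congr rfl fun k _ => ?_
  rw [integral_smul_measure, ENNReal.toReal_ofReal (intrinsicVolume_nonneg C k), smul_eq_mul,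
    mul_comm]

theorem hasLaw_nnnorm_proj_sq (C : Cone d) :
    HasLaw (fun g => ‖proj C g‖₊ ^ 2)
      (∑ k : Fin (d + 1), ENNReal.ofReal (intrinsicVolume C k) • chiSquare k)
      (stdGaussian (E d)) where
  aemeasurable := ((continuous_proj C).nnnorm.pow 2).measurable.aemeasurable
  map_eq := by
    change Measure.map (Prod.fst ∘ sqNorms C) _ = _
    rw [← Measure.map_map measurable_fst (measurable_sqNorms C), map_sqNorms_stdGaussian,
      Measure.map_finset_sum' measurable_fst.aemeasurable]
    refine Finset.sum_congr rfl fun k _ => ?_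
    rw [Measure.map_smul, Measure.map_fst_prod, measure_univ, one_smul]

end ConicSteiner

theorem theorem3p1 (d : ℕ) (C : ConicSteiner.Cone d) :
    -- the conic intrinsic volumes of `C` are well defined
    ((∃ K : ℕ → ConicSteiner.Cone d, ConicSteiner.PolyhedralApprox K C) ∧
      ∀ K : ℕ → ConicSteiner.Cone d, ConicSteiner.PolyhedralApprox K C → ∀ k : Fin (d + 1),
        Tendsto (fun i => ConicSteiner.polyhedralVolume (K i) k) atTop
          (𝓝 (ConicSteiner.intrinsicVolume C k))) ∧
    -- the master Steiner formula
    (∀ f : ℝ≥0 × ℝ≥0 → ℝ, Measurable f →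
      ∀ L : Fin (d + 1) → Submodule ℝ (ConicSteiner.E d),
        (∀ k, Module.finrank ℝ (L k) = k) →
        ConicSteiner.FinitePhi f C →
        (∀ k, ConicSteiner.FinitePhi f (ConicSteiner.subspaceCone (L k))) →
        ConicSteiner.phi f C =
          ∑ k : Fin (d + 1), ConicSteiner.phi f (ConicSteiner.subspaceCone (L k)) *
            ConicSteiner.intrinsicVolume C k) ∧
    -- its form with independent chi-square variables; `k.rev` is the index `d - k`
    (∀ f : ℝ≥0 × ℝ≥0 → ℝ, Measurable f →
      ∀ (Ω : Type*) [MeasurableSpace Ω] (P : Measure Ω) [IsProbabilityMeasure P]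
        (X X' : Fin (d + 1) → Ω → ℝ≥0),
        (∀ k, HasLaw (X k) (ConicSteiner.chiSquare k) P) →
        (∀ k, HasLaw (X' k) (ConicSteiner.chiSquare k) P) →
        iIndepFun (Sum.elim X X') P →
        ConicSteiner.FinitePhi f C →
        (∀ k, Integrable (fun ω => f (X k ω, X' k.rev ω)) P) →
        ConicSteiner.phi f C =
          ∑ k : Fin (d + 1), (∫ ω, f (X k ω, X' k.rev ω) ∂P) *
            ConicSteiner.intrinsicVolume C k) ∧
    -- the squared norm of the projection is a mixture of chi-square variables
    ((∀ k : Fin (d + 1), 0 ≤ ConicSteiner.intrinsicVolume C k) ∧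
      ∑ k : Fin (d + 1), ConicSteiner.intrinsicVolume C k = 1 ∧
      HasLaw (fun g => ‖ConicSteiner.proj C g‖₊ ^ 2)
        (∑ k : Fin (d + 1),
          ENNReal.ofReal (ConicSteiner.intrinsicVolume C k) • ConicSteiner.chiSquare k)
        (stdGaussian (ConicSteiner.E d))) := by
  refine ⟨⟨ConicSteiner.exists_polyhedralApprox C,
    fun K hK k => ConicSteiner.tendsto_polyhedralVolume hK k⟩, ?_, ?_,
    ConicSteiner.intrinsicVolume_nonneg C, ConicSteiner.sum_intrinsicVolume C,
    ConicSteiner.hasLaw_nnnorm_proj_sq C⟩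
  · intro f hf L hL _ hfin
    -- Integrals over `L k` become integrals against the product chi-square law, where the mixture
    -- identity applies.
    have hlaw : ∀ k, (stdGaussian (ConicSteiner.E d)).map
        (ConicSteiner.sqNorms (ConicSteiner.subspaceCone (L k))) =
        (ConicSteiner.chiSquare k).prod (ConicSteiner.chiSquare k.rev) := fun k => by
      rw [ConicSteiner.map_sqNorms_subspaceCone, hL, ConicSteiner.rev_eq_sub]
    rw [ConicSteiner.phi_eq_sum_integral_chiSquare C hf fun k => by
      rw [← hlaw, integrable_map_measure hf.aestronglyMeasurable
        (ConicSteiner.measurable_sqNorms _).aemeasurable]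
      exact hfin k]
    refine Finset.sum_congr rfl fun k _ => ?_
    rw [← hlaw, integral_map (ConicSteiner.measurable_sqNorms _).aemeasurable
      hf.aestronglyMeasurable, ConicSteiner.phi]
  · intro f hf Ω _ P _ X X' hX hX' hindep _ hfin
    have hmeas : ∀ k, AEMeasurable (fun ω => (X k ω, X' k.rev ω)) P := fun k =>
      (hX k).aemeasurable.prodMk (hX' k.rev).aemeasurable
    have hlaw : ∀ k, P.map (fun ω => (X k ω, X' k.rev ω)) =
        (ConicSteiner.chiSquare k).prod (ConicSteiner.chiSquare k.rev) := fun k => by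
      have hi : IndepFun (X k) (X' k.rev) P :=
        hindep.indepFun (i := Sum.inl k) (j := Sum.inr k.rev) (by simp)
      rw [(indepFun_iff_map_prod_eq_prod_map_map (hX k).aemeasurable
        (hX' k.rev).aemeasurable).1 hi, (hX k).map_eq, (hX' k.rev).map_eq]
    rw [ConicSteiner.phi_eq_sum_integral_chiSquare C hf fun k => by
      rw [← hlaw, integrable_map_measure hf.aestronglyMeasurable (hmeas k)]
      exact hfin k]
    refine Finset.sum_congr rfl fun k _ => ?_
    rw [← hlaw, integral_map (hmeas k) hf.aestronglyMeasurable]
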